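/- Let $-1<\rho<1$, $\theta\in\mathbb R$, $R=\begin{pmatrix}1&\rho\\ \rho&1\end{pmatrix}$, and let $\mathbf X=(X_1,X_2)^T\sim SN_2(\boldsymbol\theta,R)$ with $\boldsymbol\theta=(\theta,\theta)^T$; that is, $\mathbf X$ has the density $f(\mathbf x)=2\,\phi_2(\mathbf x,R)\,\Phi(\boldsymbol\theta^T\mathbf x)$ on $\mathbb R^2$, where $\phi_2(\cdot,R)$ is the density of the bivariate normal distribution with mean $\mathbf 0$ and correlation matrix $R$, and $\Phi$ is the standard normal cdf. Let $F_i$ be the cdf of $X_i$, let $F_i^{-1}(u)=\inf\{x: F_i(x)\ge u\}$, and let $$\lambda_U(u)=P\bigl(X_1\ge F_1^{-1}(u)\,\big|\,X_2\ge F_2^{-1}(u)\bigr),\qquad 0<u<1,$$ be the upper tail dependence function. Here $f\sim g$ means $f/g\to1$. Then, as $u\to1^-$: (a) if $\theta<0$, $$\lambda_U(u)\sim(1-u)^{\beta^2}\,\frac{\alpha^3}{\pi\lambda^4\beta(1+\beta^2)^2}\sqrt{\frac2\pi}\,(2\pi\lambda)^{1+\beta^2}\Bigl(\frac{1+\lambda^2}{2}\Bigr)^{3/2}\bigl[-\log(1-u)\bigr]^{\beta^2-\frac12},$$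 where $\lambda=\frac{|\theta|(1+\rho)}{\sqrt{1+\theta^2(1-\rho^2)}}$, $\alpha=\frac{|\theta|(1+\rho)}{\sqrt{1+2\theta^2(1+\rho)}}$ and $\beta=\sqrt{\frac{(1-\rho)(1+2\theta^2(1+\rho))}{1+\rho}}$; (b) if $\theta>0$, $$\lambda_U(u)\sim(1-u)^{\frac{1-\rho}{1+\rho}}\cdot\frac{1+\rho}{2}\sqrt{\frac{1+\rho}{1-\rho}}\,\bigl(-\pi\log(1-u)\bigr)^{-\frac{\rho}{1+\rho}}.$$ -/

import Mathlib

open MeasureTheory ProbabilityTheory Filter Topology Asymptotics Matrix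

noncomputable section

namespace SkewNormal

/-- The cdf `Φ` of the univariate standard normal distribution. -/
def stdNormalCDF (x : ℝ) : ℝ := cdf (gaussianReal 0 1) x

/-- The correlation matrix with off-diagonal entry `ρ`. -/
def corrMatrix (ρ : ℝ) : Matrix (Fin 2) (Fin 2) ℝ := !![1, ρ; ρ, 1]

/-- The density `φ₂(x, R)` of the bivariate normal distribution with mean `0` and positive
definite covariance matrix `R`. -/
def bivNormalPDF (R : Matrix (Fin 2) (Fin 2) ℝ) (x : Fin 2 → ℝ) : ℝ :=
  1 / (2 * Real.pi * √R.det) * Real.exp (-(1 / 2) * (x ⬝ᵥ (R⁻¹ *ᵥ x)))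

/-- The density `2 φ₂(x, R) Φ(θᵀ x)` of the bivariate skew normal distribution. -/
def skewNormalPDF (θ : Fin 2 → ℝ) (R : Matrix (Fin 2) (Fin 2) ℝ) (x : Fin 2 → ℝ) : ℝ :=
  2 * bivNormalPDF R x * stdNormalCDF (θ ⬝ᵥ x)

/-- The bivariate skew normal distribution `SN₂(θ, R)`: the measure on `ℝ²` with density
`skewNormalPDF θ R` with respect to Lebesgue measure. -/
def skewNormal (θ : Fin 2 → ℝ) (R : Matrix (Fin 2) (Fin 2) ℝ) : Measure (Fin 2 → ℝ) :=
  volume.withDensity fun x => ENNReal.ofReal (skewNormalPDF θ R x)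

/-- The inverse distribution function `F⁻¹(u) = inf {x | u ≤ F(x)}` of a distribution on `ℝ`. -/
def quantile (μ : Measure ℝ) (u : ℝ) : ℝ := sInf {x : ℝ | u ≤ cdf μ x}

/-- The upper tail dependence function
`λ_U(u) = P(X₁ ≥ F₁⁻¹(u) | X₂ ≥ F₂⁻¹(u))`, where `Fᵢ` is the cdf of the `i`-th marginal
(the coordinates are indexed by `0` and `1`). -/
def upperTailDep {Ω : Type*} [MeasurableSpace Ω] (P : Measure Ω) (X : Ω → Fin 2 → ℝ)
    (u : ℝ) : ℝ :=
  (cond P {ω | quantile (P.map fun ω => X ω 1) u ≤ X ω 1}).real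
    {ω | quantile (P.map fun ω => X ω 0) u ≤ X ω 0}

end SkewNormal

end

/-! Both marginals are univariate skew normal with the same slope `l` (`skewNormal_map_eval`), so
the two quantiles agree. With `t` the common quantile, `λ_U(u) = J(t) / M(t)`, where `J` is the
joint tail over the orthant beyond `(t, t)` and `M(t) = 1 - u` is the marginal tail
(`upperTailDep_eq`); moreover `t → ∞` as `u → 1`.

Laplace's method gives both tails. On the scale `x = t + a / t` the Gaussian factor becomes its
value at the corner times a decaying exponential in `a`, with a quadratic remainder that vanishes as
`t → ∞`. The factor `Φ` tends to `1` when `θ > 0`; when `θ < 0` it follows Mills' ratio and adds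
exponential decay of its own. `IsTailFactor` covers both cases, and dominated convergence yields
`marginal_tail_tendsto` and `joint_tail_tendsto`.

Hence `M ~ c t^(-k) exp(-K t²/2)` and `J ~ d t^(-m) exp(-K(1+b) t²/2)`. The exponential in `J / M`
is absorbed by the exact power `M^b`, and the remaining power of `t` is converted by `-log M ~ K
t²/2` (`div_isEquivalent_of_tails`). The rest is identification of constants. -/

namespace SkewNormal

/-! ### Laplace's method at the corner of a half-line or an orthant -/

section Laplace

variable {E : Type*} [NormedAddCommGroup E] [NormedSpace ℝ E] [MeasurableSpace E] [BorelSpace E]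
  [FiniteDimensional ℝ E] (μ : Measure E) [μ.IsAddHaarMeasure]

/-- Affine change of variables `x = c + t⁻¹ a` in a set integral. -/
theorem setIntegral_comp_affine {s : Set E} (hs : MeasurableSet s) (f : E → ℝ) (c : E) {t : ℝ}
    (ht : 0 < t) :
    ∫ a in s, f (c + t⁻¹ • a) ∂μ
      = t ^ Module.finrank ℝ E * ∫ x in (fun x => t • (x - c)) ⁻¹' s, f x ∂μ := by
  have hm : Measurable fun x : E => t • (x - c) := by fun_prop
  rw [← integral_indicator hs, ← integral_indicator (hm hs)]
  have key : ∀ a : E, s.indicator (fun a => f (c + t⁻¹ • a)) a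
      = ((fun x => t • (x - c)) ⁻¹' s).indicator f (c + t⁻¹ • a) := by
    intro a
    have e : t • (c + t⁻¹ • a - c) = a := by simp [smul_smul, ht.ne']
    by_cases ha : a ∈ s
    · rw [Set.indicator_of_mem ha, Set.indicator_of_mem (by simpa only [Set.mem_preimage, e])]
    · rw [Set.indicator_of_notMem ha,
        Set.indicator_of_notMem (by simpa only [Set.mem_preimage, e])]
  simp_rw [key]
  rw [Measure.integral_comp_smul μ
    (fun x => ((fun x => t • (x - c)) ⁻¹' s).indicator f (c + x)) t⁻¹,
    integral_add_left_eq_self]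
  simp [abs_of_pos ht]

/-- Laplace-type limit: after the substitution `x = c t + t⁻¹ a` dominated convergence gives the
leading behaviour of the integral of `f` over a set receding to infinity. -/
theorem tendsto_setIntegral_affine {s : Set E} (hs : MeasurableSet s) {f : E → ℝ}
    (hf : Measurable f) (c : ℝ → E) (N : ℝ → ℝ) {bound lim : E → ℝ}
    (hb : IntegrableOn bound s μ)
    (hbound : ∀ t > 0, ∀ a ∈ s, ‖f (c t + t⁻¹ • a) / N t‖ ≤ bound a)
    (hlim : ∀ a ∈ s, Tendsto (fun t => f (c t + t⁻¹ • a) / N t) atTop (𝓝 (lim a))) :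
    Tendsto (fun t : ℝ => t ^ Module.finrank ℝ E *
        (∫ x in (fun x => t • (x - c t)) ⁻¹' s, f x ∂μ) / N t) atTop
      (𝓝 (∫ a in s, lim a ∂μ)) := by
  have h : Tendsto (fun t : ℝ => ∫ a in s, f (c t + t⁻¹ • a) / N t ∂μ) atTop
      (𝓝 (∫ a in s, lim a ∂μ)) := by
    refine tendsto_integral_filter_of_dominated_convergence bound ?_ ?_ hb ?_
    · exact Eventually.of_forall fun t =>
        (Measurable.div_const (hf.comp (by fun_prop)) _).aestronglyMeasurable
    · filter_upwards [eventually_gt_atTop 0] with t ht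
      exact (ae_restrict_iff' hs).2 (Eventually.of_forall fun a ha => hbound t ht a ha)
    · exact (ae_restrict_iff' hs).2 (Eventually.of_forall fun a ha => hlim a ha)
  refine h.congr' ?_
  filter_upwards [eventually_gt_atTop 0] with t ht
  rw [integral_div, setIntegral_comp_affine μ hs f (c t) ht]

end Laplace

theorem tendsto_tail_integral {f : ℝ → ℝ} (hf : Measurable f) (N : ℝ → ℝ) {bound lim : ℝ → ℝ}
    (hb : IntegrableOn bound (Set.Ioi 0))
    (hbound : ∀ t > 0, ∀ a > 0, ‖f (t + a / t) / N t‖ ≤ bound a)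
    (hlim : ∀ a > 0, Tendsto (fun t => f (t + a / t) / N t) atTop (𝓝 (lim a))) :
    Tendsto (fun t : ℝ => t * (∫ x in Set.Ioi t, f x) / N t) atTop
      (𝓝 (∫ a in Set.Ioi 0, lim a)) := by
  have e : ∀ t a : ℝ, t + a / t = t + t⁻¹ • a := fun t a => by
    rw [smul_eq_mul]; ring
  simp only [e] at hbound hlim
  have h := tendsto_setIntegral_affine volume measurableSet_Ioi hf (fun t => t) N hb
    hbound hlim
  refine h.congr' ?_
  filter_upwards [eventually_gt_atTop 0] with t ht
  have : (fun x => t • (x - t)) ⁻¹' Set.Ioi 0 = Set.Ioi t := by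
    ext x; simp [ht]
  rw [this]; simp

theorem tendsto_orthant_integral {f : (Fin 2 → ℝ) → ℝ} (hf : Measurable f) (N : ℝ → ℝ)
    {bound lim : (Fin 2 → ℝ) → ℝ}
    (hb : IntegrableOn bound (Set.univ.pi fun _ => Set.Ioi 0))
    (hbound : ∀ t > 0, ∀ a b : ℝ, 0 < a → 0 < b →
      ‖f ![t + a / t, t + b / t] / N t‖ ≤ bound ![a, b])
    (hlim : ∀ a b : ℝ, 0 < a → 0 < b →
      Tendsto (fun t => f ![t + a / t, t + b / t] / N t) atTop (𝓝 (lim ![a, b]))) :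
    Tendsto (fun t : ℝ => t ^ 2 * (∫ x in Set.univ.pi fun _ => Set.Ioi t, f x) / N t) atTop
      (𝓝 (∫ a in Set.univ.pi fun _ => Set.Ioi 0, lim a)) := by
  have e : ∀ (t : ℝ) (a : Fin 2 → ℝ), (fun _ => t) + t⁻¹ • a = ![t + a 0 / t, t + a 1 / t] := by
    intro t a
    ext i; fin_cases i <;> simp <;> ring
  have e2 : ∀ a : Fin 2 → ℝ, a = ![a 0, a 1] := fun a => by ext i; fin_cases i <;> rfl
  have h := tendsto_setIntegral_affine (volume : Measure (Fin 2 → ℝ))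
    (MeasurableSet.univ_pi fun _ => measurableSet_Ioi) hf
    (fun t _ => t) N hb (lim := lim)
    (fun t ht a ha => by
      rw [e]; rw [Set.mem_univ_pi] at ha
      simpa [← e2] using hbound t ht (a 0) (a 1) (ha 0) (ha 1))
    (fun a ha => by
      simp only [e]; rw [Set.mem_univ_pi] at ha
      simpa [← e2] using hlim (a 0) (a 1) (ha 0) (ha 1))
  refine h.congr' ?_
  filter_upwards [eventually_gt_atTop 0] with t ht
  have : (fun x : Fin 2 → ℝ => t • (x - fun _ => t)) ⁻¹' (Set.univ.pi fun _ => Set.Ioi 0)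
      = Set.univ.pi fun _ => Set.Ioi t := by
    ext x; simp [ht]
  rw [this]; simp

theorem integrableOn_exp_orthant {c : ℝ} (hc : 0 < c) :
    IntegrableOn (fun x : Fin 2 → ℝ => Real.exp (-c * (x 0 + x 1)))
      (Set.univ.pi fun _ => Set.Ioi 0) := by
  have h := Integrable.fintype_prod (ι := Fin 2) (f := fun _ x => Real.exp (-c * x))
    (μ := fun _ => (volume : Measure ℝ).restrict (Set.Ioi 0))
    fun _ => integrableOn_exp_mul_Ioi (neg_lt_zero.2 hc) 0
  -- Lebesgue measure restricted to the orthant is the product of its restrictions to half-lines, so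
  -- the exponential factorizes.
  rw [← Measure.restrict_pi_pi] at h
  refine h.congr (Eventually.of_forall fun x => ?_)
  simp [Fin.prod_univ_two, mul_add, Real.exp_add]

theorem integral_exp_orthant {c : ℝ} (hc : 0 < c) :
    ∫ x in Set.univ.pi fun _ : Fin 2 => Set.Ioi (0 : ℝ), Real.exp (-c * (x 0 + x 1))
      = 1 / c ^ 2 := by
  have h := integral_fintype_prod_eq_prod (ι := Fin 2) (𝕜 := ℝ)
    (fun _ (x : ℝ) => Real.exp (-c * x)) (μ := fun _ => volume.restrict (Set.Ioi 0))
  rw [← Measure.restrict_pi_pi] at h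
  simp only [Fin.prod_univ_two, ← Real.exp_add, ← mul_add] at h
  refine h.trans ?_
  rw [integral_exp_mul_Ioi (neg_lt_zero.2 hc)]
  simp
  field_simp

/-! ### Standard normal density and Mills' ratio -/

/-- The standard normal density in explicit form. -/
theorem stdNormalPDF_eq (x : ℝ) :
    gaussianPDFReal 0 1 x = (√(2 * Real.pi))⁻¹ * Real.exp (-x ^ 2 / 2) := by
  simp [gaussianPDFReal]

theorem stdNormalPDF_pos (x : ℝ) : 0 < gaussianPDFReal 0 1 x :=
  gaussianPDFReal_pos _ _ _ one_ne_zero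

/-- Since `(t + v/t)² = t² + 2v + v²/t²`, the step `1/t` is the scale on which the linear term
survives and the quadratic one disappears. -/
theorem stdNormalPDF_div {t : ℝ} (ht : 0 < t) (κ v : ℝ) :
    gaussianPDFReal 0 1 (κ * (t + v / t)) / gaussianPDFReal 0 1 (κ * t)
      = Real.exp (-κ ^ 2 * v - κ ^ 2 * v ^ 2 / (2 * t ^ 2)) := by
  rw [div_eq_iff (stdNormalPDF_pos _).ne', stdNormalPDF_eq, stdNormalPDF_eq,
    mul_left_comm, ← Real.exp_add]
  congr 2
  field_simp
  ring

theorem tendsto_add_div_atTop (v : ℝ) : Tendsto (fun t : ℝ => t + v / t) atTop atTop :=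
  tendsto_id.atTop_add (tendsto_const_nhds.div_atTop tendsto_id)

theorem tendsto_div_sq (c d : ℝ) : Tendsto (fun t : ℝ => c - d / (2 * t ^ 2)) atTop (𝓝 c) := by
  have : Tendsto (fun t : ℝ => 2 * t ^ 2) atTop atTop :=
    (tendsto_pow_atTop two_ne_zero).const_mul_atTop two_pos
  simpa using tendsto_const_nhds.sub (tendsto_const_nhds.div_atTop this)

theorem stdNormalCDF_eq_real (x : ℝ) :
    stdNormalCDF x = (gaussianReal 0 1).real (Set.Iic x) := cdf_eq_real _ _

theorem stdNormalCDF_nonneg (x : ℝ) : 0 ≤ stdNormalCDF x := cdf_nonneg _ _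

theorem stdNormalCDF_le_one (x : ℝ) : stdNormalCDF x ≤ 1 := cdf_le_one _ _

theorem stdNormalCDF_mono : Monotone stdNormalCDF := monotone_cdf _

theorem measurable_stdNormalCDF : Measurable stdNormalCDF := stdNormalCDF_mono.measurable

theorem stdNormalCDF_neg (z : ℝ) :
    stdNormalCDF (-z) = ∫ x in Set.Ioi z, gaussianPDFReal 0 1 x := by
  rw [stdNormalCDF_eq_real, measureReal_def, gaussianReal_apply_eq_integral _ one_ne_zero,
    ENNReal.toReal_ofReal
      (integral_nonneg fun x => gaussianPDFReal_nonneg _ _ _),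
    ← integral_comp_neg_Ioi]
  simp [gaussianPDFReal]

theorem stdNormalCDF_pos (x : ℝ) : 0 < stdNormalCDF x := by
  rw [← neg_neg x, stdNormalCDF_neg, setIntegral_pos_iff_support_of_nonneg_ae
    (Eventually.of_forall fun x => gaussianPDFReal_nonneg _ _ _)
    (integrable_gaussianPDFReal _ _).integrableOn]
  have : Function.support (gaussianPDFReal 0 1) = Set.univ := by
    ext x; simp [(stdNormalPDF_pos x).ne']
  rw [this]; simp

theorem mills_tendsto :
    Tendsto (fun z : ℝ => z * stdNormalCDF (-z) / gaussianPDFReal 0 1 z) atTop (𝓝 1) := by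
  have h := tendsto_tail_integral (measurable_gaussianPDFReal 0 1) (gaussianPDFReal 0 1)
    (bound := fun a => Real.exp (-1 * a)) (lim := fun a => Real.exp (-1 * a))
    (integrableOn_exp_mul_Ioi (by norm_num) 0)
    (fun t ht a ha => by
      have := stdNormalPDF_div ht 1 a
      rw [one_mul, one_mul] at this
      rw [this, Real.norm_eq_abs, Real.abs_exp]
      refine Real.exp_le_exp.2 ?_
      have : 0 ≤ 1 ^ 2 * a ^ 2 / (2 * t ^ 2) := by positivity
      linarith)
    (fun a _ => by
      have h1 := (Real.continuous_exp.tendsto _).comp (tendsto_div_sq (-1 * a) (a ^ 2))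
      refine h1.congr' ?_
      filter_upwards [eventually_gt_atTop 0] with t ht
      have := stdNormalPDF_div ht 1 a
      rw [one_mul, one_mul] at this
      rw [this]
      simp)
  rw [integral_exp_mul_Ioi (by norm_num)] at h
  simpa [stdNormalCDF_neg] using h

/-- After `x = z + a/z` the factor `exp(-a²/(2z²))` is at most `1`, and `exp(-a)` integrates to `1`.
Unlike the limit, this bound holds for every `z > 0`, as domination requires. -/
theorem mills_le {z : ℝ} (hz : 0 < z) : stdNormalCDF (-z) ≤ gaussianPDFReal 0 1 z / z := by
  have h := setIntegral_comp_affine volume measurableSet_Ioi (s := Set.Ioi 0)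
    (gaussianPDFReal 0 1) z hz
  have e : (fun x => z • (x - z)) ⁻¹' Set.Ioi 0 = Set.Ioi z := by
    ext x; simp [hz]
  rw [e, ← stdNormalCDF_neg, Module.finrank_self, pow_one] at h
  rw [le_div_iff₀' hz, ← h]
  have hi := integral_exp_mul_Ioi (show (-1 : ℝ) < 0 by norm_num) 0
  have : gaussianPDFReal 0 1 z
      = ∫ a in Set.Ioi (0 : ℝ), gaussianPDFReal 0 1 z * Real.exp (-1 * a) := by
    rw [integral_const_mul, hi]; simp
  rw [this]
  refine integral_mono_of_nonneg (Eventually.of_forall fun x => gaussianPDFReal_nonneg _ _ _)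
    ((integrableOn_exp_mul_Ioi (by norm_num) 0).const_mul _) ?_
  refine (ae_restrict_iff' measurableSet_Ioi).2 (Eventually.of_forall fun a ha => ?_)
  have h1 := stdNormalPDF_div hz 1 a
  rw [one_mul, one_mul, div_eq_iff (stdNormalPDF_pos _).ne'] at h1
  have h2 : z + z⁻¹ • a = z + a / z := by rw [smul_eq_mul]; ring
  simp only [h2]
  rw [h1, mul_comm]
  refine mul_le_mul_of_nonneg_left (Real.exp_le_exp.2 ?_) (stdNormalPDF_pos _).le
  have : 0 ≤ 1 ^ 2 * a ^ 2 / (2 * z ^ 2) := by positivity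
  linarith

/-! ### Order of the factor `Φ` near the threshold -/

/-- `ψ t` is the exact order of `Φ (c (t + v / t))` as `t → ∞`, with limiting ratio
`exp (-η v)`, and an upper bound for it. -/
structure IsTailFactor (c : ℝ) (ψ : ℝ → ℝ) (η : ℝ) : Prop where
  pos : ∀ t > 0, 0 < ψ t
  le : ∀ t > 0, ∀ v ≥ 0, stdNormalCDF (c * (t + v / t)) ≤ ψ t
  tendsto : ∀ v ≥ 0,
    Tendsto (fun t => stdNormalCDF (c * (t + v / t)) / ψ t) atTop (𝓝 (Real.exp (-η * v)))
  nonneg : 0 ≤ η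

theorem isTailFactor_pos {c : ℝ} (hc : 0 < c) : IsTailFactor c (fun _ => 1) 0 where
  pos _ _ := one_pos
  le _ _ _ _ := stdNormalCDF_le_one _
  tendsto v _ := by
    simpa [stdNormalCDF] using! (tendsto_cdf_atTop (gaussianReal 0 1)).comp
      ((tendsto_add_div_atTop v).const_mul_atTop hc)
  nonneg := le_rfl

theorem isTailFactor_neg {κ : ℝ} (hκ : 0 < κ) :
    IsTailFactor (-κ) (fun t => gaussianPDFReal 0 1 (κ * t) / (κ * t)) (κ ^ 2) where
  pos t ht := div_pos (stdNormalPDF_pos _) (by positivity)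
  le t ht v hv := by
    have hw : t ≤ t + v / t := le_add_of_nonneg_right (by positivity)
    rw [neg_mul]
    refine (mills_le (by positivity)).trans ?_
    refine div_le_div₀ (stdNormalPDF_pos _).le ?_ (by positivity)
      (mul_le_mul_of_nonneg_left hw hκ.le)
    rw [stdNormalPDF_eq, stdNormalPDF_eq]
    gcongr
  tendsto v hv := by
    -- With `w = t + v/t`, the ratio is the product of Mills' ratio at `κw`, the density ratio
    -- `φ(κw)/φ(κt)`, and `t/w`; their limits are `1`, `exp(-κ²v)` and `1`.
    have h1 := mills_tendsto.comp ((tendsto_add_div_atTop v).const_mul_atTop hκ)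
    have h2 := (Real.continuous_exp.tendsto _).comp (tendsto_div_sq (-κ ^ 2 * v) (κ ^ 2 * v ^ 2))
    have h3 : Tendsto (fun t : ℝ => (1 + v / t ^ 2)⁻¹) atTop (𝓝 1) := by
      have : Tendsto (fun t : ℝ => 1 + v / t ^ 2) atTop (𝓝 (1 + 0)) :=
        tendsto_const_nhds.add
          (tendsto_const_nhds.div_atTop (tendsto_pow_atTop two_ne_zero))
      simpa using this.inv₀ (by norm_num)
    have h := (h1.mul h2).mul h3
    rw [one_mul, mul_one] at h
    refine h.congr' ?_
    filter_upwards [eventually_gt_atTop 0] with t ht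
    simp only [Function.comp]
    rw [← stdNormalPDF_div ht]
    have p1 := (stdNormalPDF_pos (κ * (t + v / t))).ne'
    have p2 := (stdNormalPDF_pos (κ * t)).ne'
    have p3 : t ^ 2 + v ≠ 0 := by positivity
    have e3 : (1 + v / t ^ 2)⁻¹ = t / (t + v / t) := by field_simp
    have p4 : t + v / t ≠ 0 := by positivity
    rw [e3, neg_mul]
    generalize t + v / t = w at *
    field_simp
  nonneg := by positivity

/-! ### Marginals of the bivariate skew normal law -/

theorem ofReal_stdNormalCDF (x : ℝ) :
    ENNReal.ofReal (stdNormalCDF x) = gaussianReal 0 1 (Set.Iic x) := ofReal_cdf _ _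

theorem gaussianReal_Iic (m : ℝ) {v : NNReal} (hv : v ≠ 0) (x : ℝ) :
    gaussianReal m v (Set.Iic x) = gaussianReal 0 1 (Set.Iic ((x - m) / √v)) := by
  have hs : 0 < √(v : ℝ) := Real.sqrt_pos.2 (by positivity)
  have h : gaussianReal m v = (gaussianReal 0 1).map fun z => √(v : ℝ) * z + m := by
    have := Measure.map_map (μ := gaussianReal 0 1) (g := fun x => x + m)
      (f := fun z => √(v : ℝ) * z) (by fun_prop) (by fun_prop)
    rw [gaussianReal_map_const_mul, gaussianReal_map_add_const] at this
    rw [Function.comp_def] at this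
    rw [← this]
    congr 1
    · simp
    · ext; simp
  rw [h, Measure.map_apply (by fun_prop) measurableSet_Iic]
  congr 1
  ext z
  simp [le_div_iff₀ hs, le_sub_iff_add_le, mul_comm]

/-- Averaging `Φ (θ (x + Y))` over a normal variable `Y` gives again a normal cdf value. -/
theorem lintegral_stdNormalCDF_gaussianReal (m θ x : ℝ) (v : NNReal) :
    ∫⁻ y, ENNReal.ofReal (stdNormalCDF (θ * (x + y))) ∂gaussianReal m v
      = ENNReal.ofReal (stdNormalCDF (θ * (x + m) / √(1 + θ ^ 2 * v))) := by
  -- For independent `Y ~ N(m, v)` and `Z ~ N(0, 1)`, the average is `P(Z ≤ θ(x + Y)) = P(-θY + Z ≤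
  -- θx)`, and `-θY + Z` is normal with mean `-θm` and variance `θ²v + 1`.
  have hconv : ((gaussianReal m v).map (fun y => -θ * y)) ∗ gaussianReal 0 1
      = gaussianReal (-θ * m + 0) (NNReal.mk ((-θ) ^ 2) (sq_nonneg _) * v + 1) := by
    rw [gaussianReal_map_const_mul, gaussianReal_conv_gaussianReal]
  have h := congrArg (fun μ : Measure ℝ => μ (Set.Iic (θ * x))) hconv
  rw [gaussianReal_Iic _ (by positivity), Measure.conv,
    Measure.map_apply (by fun_prop) measurableSet_Iic,
    Measure.prod_apply (measurableSet_Iic.preimage (by fun_prop)),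
    lintegral_map (measurable_measure_prodMk_left (measurableSet_Iic.preimage (by fun_prop)))
      (by fun_prop)] at h
  rw [ofReal_stdNormalCDF]
  convert h using 3 with y
  · rw [ofReal_stdNormalCDF]
    congr 1
    ext w
    simp only [Set.mem_Iic, Set.mem_preimage]
    constructor <;> intro h <;> linarith
  · congr 1
    · ring
    · congr 1
      push_cast
      simp
      ring

/-- The density of `SN₂((θ, θ), R)` in coordinates. -/
theorem skewNormalPDF_eq {ρ : ℝ} (hρ : -1 < ρ) (hρ' : ρ < 1) (θ : ℝ) (x : Fin 2 → ℝ) :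
    skewNormalPDF ![θ, θ] (corrMatrix ρ) x
      = 2 * (1 / (2 * Real.pi * √(1 - ρ ^ 2))
        * Real.exp (-(x 0 ^ 2 - 2 * ρ * x 0 * x 1 + x 1 ^ 2) / (2 * (1 - ρ ^ 2))))
        * stdNormalCDF (θ * (x 0 + x 1)) := by
  have hd : (corrMatrix ρ).det = 1 - ρ ^ 2 := by
    rw [corrMatrix, Matrix.det_fin_two_of]; ring
  have hpos : 0 < 1 - ρ ^ 2 := by nlinarith
  have hinv : (corrMatrix ρ)⁻¹ = (1 - ρ ^ 2)⁻¹ • !![1, -ρ; -ρ, 1] := by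
    rw [Matrix.inv_def, hd, Ring.inverse_eq_inv', corrMatrix, Matrix.adjugate_fin_two_of]
  rw [skewNormalPDF, bivNormalPDF, hd, hinv]
  congr 2
  · have e : -(1 / 2) * (x ⬝ᵥ ((1 - ρ ^ 2)⁻¹ • !![1, -ρ; -ρ, 1]) *ᵥ x)
        = -(x 0 ^ 2 - 2 * ρ * x 0 * x 1 + x 1 ^ 2) / (2 * (1 - ρ ^ 2)) := by
      simp [Matrix.mulVec, dotProduct, Fin.sum_univ_two]
      field_simp
      ring
    rw [e]
  · simp [dotProduct, Fin.sum_univ_two]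
    ring

theorem measurable_skewNormalPDF {ρ : ℝ} (hρ : -1 < ρ) (hρ' : ρ < 1) (θ : ℝ) :
    Measurable (skewNormalPDF ![θ, θ] (corrMatrix ρ)) := by
  rw [funext (skewNormalPDF_eq hρ hρ' θ)]
  have := measurable_stdNormalCDF
  fun_prop

theorem skewNormalPDF_pos {ρ : ℝ} (hρ : -1 < ρ) (hρ' : ρ < 1) (θ : ℝ) (x : Fin 2 → ℝ) :
    0 < skewNormalPDF ![θ, θ] (corrMatrix ρ) x := by
  rw [skewNormalPDF_eq hρ hρ']
  have h1 := stdNormalCDF_pos (θ * (x 0 + x 1))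
  have hpos : 0 < 1 - ρ ^ 2 := by nlinarith
  positivity

/-- The density `2 φ(x) Φ(l x)` of the univariate skew normal distribution. -/
noncomputable def marginalPDF (l x : ℝ) : ℝ := 2 * gaussianPDFReal 0 1 x * stdNormalCDF (l * x)

theorem marginalPDF_pos (l x : ℝ) : 0 < marginalPDF l x :=
  mul_pos (mul_pos two_pos (stdNormalPDF_pos x)) (stdNormalCDF_pos _)

theorem measurable_marginalPDF (l : ℝ) : Measurable (marginalPDF l) := by
  have := measurable_stdNormalCDF
  have := measurable_gaussianPDFReal 0 1
  unfold marginalPDF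
  fun_prop

/-- Integrating the joint density over the second coordinate. -/
theorem lintegral_skewNormalPDF_snd {ρ : ℝ} (hρ : -1 < ρ) (hρ' : ρ < 1) (θ x : ℝ) :
    ∫⁻ y, ENNReal.ofReal (skewNormalPDF ![θ, θ] (corrMatrix ρ) ![x, y])
      = ENNReal.ofReal (marginalPDF (θ * (1 + ρ) / √(1 + θ ^ 2 * (1 - ρ ^ 2))) x) := by
  have hpos : 0 < 1 - ρ ^ 2 := by nlinarith
  set v : NNReal := ⟨1 - ρ ^ 2, hpos.le⟩ with hv
  have hvc : (v : ℝ) = 1 - ρ ^ 2 := rfl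
  have hv0 : v ≠ 0 := by
    intro h; rw [h] at hvc; simp at hvc; linarith
  -- Completing the square: in the Gaussian part, the second coordinate given the first is `N(ρx, 1
  -- - ρ²)`.
  have hfac : ∀ y, ENNReal.ofReal (skewNormalPDF ![θ, θ] (corrMatrix ρ) ![x, y])
      = ENNReal.ofReal (2 * gaussianPDFReal 0 1 x)
        * (gaussianPDF (ρ * x) v y * ENNReal.ofReal (stdNormalCDF (θ * (x + y)))) := by
    intro y
    rw [gaussianPDF, ← ENNReal.ofReal_mul (gaussianPDFReal_nonneg _ _ _), ← ENNReal.ofReal_mul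
      (mul_nonneg two_pos.le (gaussianPDFReal_nonneg _ _ _)), skewNormalPDF_eq hρ hρ',
      ← mul_assoc (2 * _), stdNormalPDF_eq, gaussianPDFReal, hvc]
    congr 2
    have e1 : √(2 * Real.pi * (1 - ρ ^ 2)) = √(2 * Real.pi) * √(1 - ρ ^ 2) :=
      Real.sqrt_mul (by positivity) _
    have e2 : √(2 * Real.pi) * √(2 * Real.pi) = 2 * Real.pi := Real.mul_self_sqrt (by positivity)
    have e3 : Real.exp (-(x ^ 2 - 2 * ρ * x * y + y ^ 2) / (2 * (1 - ρ ^ 2)))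
        = Real.exp (-x ^ 2 / 2) * Real.exp (-(y - ρ * x) ^ 2 / (2 * (1 - ρ ^ 2))) := by
      rw [← Real.exp_add]
      congr 1
      field_simp
      ring
    simp only [Matrix.cons_val_zero, Matrix.cons_val_one]
    have e4 : 1 / (2 * Real.pi * √(1 - ρ ^ 2))
        = (√(2 * Real.pi))⁻¹ * (√(2 * Real.pi) * √(1 - ρ ^ 2))⁻¹ := by
      rw [← mul_inv, ← mul_assoc, e2, one_div]
    rw [e1, e3, e4]
    ring
  have hm : Measurable fun y => ENNReal.ofReal (stdNormalCDF (θ * (x + y))) := by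
    have := measurable_stdNormalCDF
    fun_prop
  simp_rw [hfac]
  rw [lintegral_const_mul _ (by fun_prop)]
  have := lintegral_withDensity_eq_lintegral_mul (volume : Measure ℝ)
    (measurable_gaussianPDF (ρ * x) v) hm
  rw [← gaussianReal_of_var_ne_zero _ hv0, lintegral_stdNormalCDF_gaussianReal] at this
  simp only [Pi.mul_apply] at this
  rw [← this, ← ENNReal.ofReal_mul (mul_nonneg two_pos.le (gaussianPDFReal_nonneg _ _ _)),
    marginalPDF, hvc]
  congr 3
  ring

/-- Both marginals of `SN₂((θ, θ), R)` are univariate skew normal. -/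
theorem skewNormal_map_eval {ρ : ℝ} (hρ : -1 < ρ) (hρ' : ρ < 1) (θ : ℝ) (i : Fin 2) :
    (skewNormal ![θ, θ] (corrMatrix ρ)).map (fun x => x i)
      = volume.withDensity fun x =>
        ENNReal.ofReal (marginalPDF (θ * (1 + ρ) / √(1 + θ ^ 2 * (1 - ρ ^ 2))) x) := by
  have hmeas := measurable_skewNormalPDF hρ hρ' θ
  ext A hA
  have hA' : MeasurableSet ((fun x : Fin 2 → ℝ => x i) ⁻¹' A) := measurable_pi_apply i hA
  set g : ℝ × ℝ → ENNReal := fun z =>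
    A.indicator (fun _ => ENNReal.ofReal (skewNormalPDF ![θ, θ] (corrMatrix ρ) ![z.1, z.2])) z.1
    with hg
  have hgm : Measurable g := by
    have h1 : Measurable fun z : ℝ × ℝ =>
        ENNReal.ofReal (skewNormalPDF ![θ, θ] (corrMatrix ρ) ![z.1, z.2]) := by
      refine ENNReal.measurable_ofReal.comp (hmeas.comp ?_)
      refine measurable_pi_iff.2 fun j => ?_
      fin_cases j
      · exact measurable_fst
      · exact measurable_snd
    exact h1.indicator (measurable_fst hA)
  have hmain : ∫⁻ z, g z = (volume.withDensity fun x =>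
      ENNReal.ofReal (marginalPDF (θ * (1 + ρ) / √(1 + θ ^ 2 * (1 - ρ ^ 2))) x)) A := by
    rw [Measure.volume_eq_prod, lintegral_prod _ hgm.aemeasurable, withDensity_apply _ hA,
      ← lintegral_indicator hA]
    refine lintegral_congr fun x => ?_
    by_cases hx : x ∈ A
    · simp only [hg, Set.indicator_of_mem hx]
      exact lintegral_skewNormalPDF_snd hρ hρ' θ x
    · simp [hg, Set.indicator_of_notMem hx]
  have e2 : ∀ a : Fin 2 → ℝ, ![a 0, a 1] = a := fun a => by ext i; fin_cases i <;> rfl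
  rw [Measure.map_apply (measurable_pi_apply i) hA, skewNormal, withDensity_apply _ hA',
    ← lintegral_indicator hA', ← hmain]
  fin_cases i
  · rw [← (volume_preserving_finTwoArrow ℝ).lintegral_comp hgm]
    refine lintegral_congr fun x => ?_
    by_cases hx : x 0 ∈ A
    · rw [Set.indicator_of_mem (by exact hx)]
      simp [hg, Set.indicator_of_mem hx, e2]
    · rw [Set.indicator_of_notMem (by exact hx)]
      simp [hg, Set.indicator_of_notMem hx]
  -- The second marginal reduces to the first because the density is symmetric under exchange of
  -- coordinates.
  · rw [Measure.volume_eq_prod, ← lintegral_prod_swap, ← Measure.volume_eq_prod,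
      ← (volume_preserving_finTwoArrow ℝ).lintegral_comp (f := fun z => g z.swap)
        (hgm.comp measurable_swap)]
    refine lintegral_congr fun x => ?_
    by_cases hx : x 1 ∈ A
    · rw [Set.indicator_of_mem (by exact hx)]
      simp only [hg, MeasurableEquiv.finTwoArrow_apply, Prod.swap_prod_mk,
        Set.indicator_of_mem hx]
      rw [skewNormalPDF_eq hρ hρ', skewNormalPDF_eq hρ hρ']
      simp only [Matrix.cons_val_zero, Matrix.cons_val_one]
      congr 2
      · congr 4
        ring
      · rw [add_comm]
    · rw [Set.indicator_of_notMem (by exact hx)]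
      simp [hg, Set.indicator_of_notMem hx]

/-! ### Marginal and joint tails relative to a tail factor -/

theorem real_withDensity_ofReal {α : Type*} [MeasurableSpace α] (μ : Measure α) {f : α → ℝ}
    (hf : Measurable f) (hpos : ∀ x, 0 ≤ f x) {s : Set α} (hs : MeasurableSet s) :
    (μ.withDensity fun x => ENNReal.ofReal (f x)).real s = ∫ x in s, f x ∂μ := by
  rw [measureReal_def, withDensity_apply _ hs, integral_eq_lintegral_of_nonneg_ae
    (Eventually.of_forall hpos) hf.aestronglyMeasurable]

/-- On the scale `a/t` the Gaussian contributes `exp(-a)` and `Φ` contributes `exp(-ηa)`. The bound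
`ψ` on `Φ` keeps the integrand below `exp(-a)`. -/
theorem marginal_tail_tendsto {l η : ℝ} {ψ : ℝ → ℝ} (h : IsTailFactor l ψ η) :
    Tendsto (fun t : ℝ => t * (∫ x in Set.Ioi t, marginalPDF l x)
      / (2 * gaussianPDFReal 0 1 t * ψ t)) atTop (𝓝 (1 / (1 + η))) := by
  have hη := h.nonneg
  have ratio : ∀ t > 0, ∀ a : ℝ, marginalPDF l (t + a / t) / (2 * gaussianPDFReal 0 1 t * ψ t)
      = Real.exp (-a - a ^ 2 / (2 * t ^ 2)) * (stdNormalCDF (l * (t + a / t)) / ψ t) := by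
    intro t ht a
    have h1 := stdNormalPDF_div ht 1 a
    rw [one_mul, one_mul, one_pow, neg_one_mul, one_mul] at h1
    rw [← h1, marginalPDF]
    have := h.pos t ht
    have := stdNormalPDF_pos t
    field_simp
  have key := tendsto_tail_integral (measurable_marginalPDF l)
    (fun t => 2 * gaussianPDFReal 0 1 t * ψ t)
    (bound := fun a => Real.exp (-1 * a)) (lim := fun a => Real.exp (-(1 + η) * a))
    (integrableOn_exp_mul_Ioi (by norm_num) 0)
    (fun t ht a ha => by
      have hψ := h.pos t ht
      rw [ratio t ht, Real.norm_eq_abs, abs_of_nonneg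
        (mul_nonneg (Real.exp_pos _).le (div_nonneg (stdNormalCDF_nonneg _) hψ.le))]
      refine (mul_le_of_le_one_right (Real.exp_pos _).le
        ((div_le_one hψ).2 (h.le t ht a ha.le))).trans ?_
      refine Real.exp_le_exp.2 ?_
      have : 0 ≤ a ^ 2 / (2 * t ^ 2) := by positivity
      linarith)
    (fun a ha => by
      have h1 := ((Real.continuous_exp.tendsto _).comp (tendsto_div_sq (-a) (a ^ 2))).mul
        (h.tendsto a ha.le)
      rw [← Real.exp_add, show -a + -η * a = -(1 + η) * a by ring] at h1
      refine h1.congr' ?_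
      filter_upwards [eventually_gt_atTop 0] with t ht
      rw [ratio t ht]; rfl)
  rw [integral_exp_mul_Ioi (by linarith)] at key
  convert key using 2
  simp
  rw [← neg_div_neg_eq, neg_neg, ← one_div]
  congr 1
  ring

/-- At `(t, t)` the Gaussian exponent is `-t²/(1+ρ)`, with slope `-t/(1+ρ)` in each coordinate. The
coordinate sum is `2(t + v/t)` with `v = (a+b)/2`; hence the slope `2θ` for the tail factor and the
rate `η/2` per coordinate. -/
theorem joint_tail_tendsto {ρ θ η : ℝ} (hρ : -1 < ρ) (hρ' : ρ < 1) {ψ : ℝ → ℝ}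
    (h : IsTailFactor (2 * θ) ψ η) :
    Tendsto (fun t : ℝ => t ^ 2 * (∫ x in Set.univ.pi fun _ => Set.Ioi t,
        skewNormalPDF ![θ, θ] (corrMatrix ρ) x)
      / (1 / (Real.pi * √(1 - ρ ^ 2)) * Real.exp (-t ^ 2 / (1 + ρ)) * ψ t)) atTop
      (𝓝 (1 / (1 / (1 + ρ) + η / 2) ^ 2)) := by
  have hη := h.nonneg
  have hpos : 0 < 1 - ρ ^ 2 := by nlinarith
  have hρ1 : 0 < 1 + ρ := by linarith
  have hs : 0 < √(1 - ρ ^ 2) := Real.sqrt_pos.2 hpos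
  have hpi := Real.pi_pos
  have hc : 0 < 1 / (1 + ρ) := by positivity
  have ratio : ∀ t > 0, ∀ a b : ℝ,
      skewNormalPDF ![θ, θ] (corrMatrix ρ) ![t + a / t, t + b / t]
        / (1 / (Real.pi * √(1 - ρ ^ 2)) * Real.exp (-t ^ 2 / (1 + ρ)) * ψ t)
      = Real.exp (-(1 / (1 + ρ)) * (a + b)
          - (a ^ 2 - 2 * ρ * a * b + b ^ 2) / (1 - ρ ^ 2) / (2 * t ^ 2))
        * (stdNormalCDF (2 * θ * (t + (a + b) / 2 / t)) / ψ t) := by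
    intro t ht a b
    rw [skewNormalPDF_eq hρ hρ']
    simp only [Matrix.cons_val_zero, Matrix.cons_val_one]
    have e1 : θ * (t + a / t + (t + b / t)) = 2 * θ * (t + (a + b) / 2 / t) := by
      field_simp; ring
    have e2 : Real.exp (-((t + a / t) ^ 2 - 2 * ρ * (t + a / t) * (t + b / t) + (t + b / t) ^ 2)
          / (2 * (1 - ρ ^ 2)))
        = Real.exp (-t ^ 2 / (1 + ρ)) * Real.exp (-(1 / (1 + ρ)) * (a + b)
          - (a ^ 2 - 2 * ρ * a * b + b ^ 2) / (1 - ρ ^ 2) / (2 * t ^ 2)) := by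
      rw [← Real.exp_add]
      congr 1
      have : (1 - ρ) ≠ 0 := by linarith
      rw [show (1 - ρ ^ 2) = (1 - ρ) * (1 + ρ) by ring]
      field_simp
      ring
    have := h.pos t ht
    rw [e1, e2]
    field_simp
  -- The quadratic remainder is nonnegative, as `a² - 2ρab + b² = (a - ρb)² + (1-ρ²)b²`, so dropping
  -- it gives the dominating function.
  have hQ : ∀ a b : ℝ, 0 ≤ (a ^ 2 - 2 * ρ * a * b + b ^ 2) / (1 - ρ ^ 2) := fun a b =>
    div_nonneg (by nlinarith [sq_nonneg (a - ρ * b), sq_nonneg b]) hpos.le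
  have key := tendsto_orthant_integral (measurable_skewNormalPDF hρ hρ' θ)
    (fun t => 1 / (Real.pi * √(1 - ρ ^ 2)) * Real.exp (-t ^ 2 / (1 + ρ)) * ψ t)
    (bound := fun x => Real.exp (-(1 / (1 + ρ)) * (x 0 + x 1)))
    (lim := fun x => Real.exp (-(1 / (1 + ρ) + η / 2) * (x 0 + x 1)))
    (integrableOn_exp_orthant hc)
    (fun t ht a b ha hb => by
      have hψ := h.pos t ht
      rw [ratio t ht, Real.norm_eq_abs, abs_of_nonneg
        (mul_nonneg (Real.exp_pos _).le (div_nonneg (stdNormalCDF_nonneg _) hψ.le))]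
      refine (mul_le_of_le_one_right (Real.exp_pos _).le
        ((div_le_one hψ).2 (h.le t ht _ (by positivity)))).trans ?_
      refine Real.exp_le_exp.2 ?_
      have := div_nonneg (hQ a b) (show 0 ≤ 2 * t ^ 2 by positivity)
      simp only [Matrix.cons_val_zero, Matrix.cons_val_one]
      linarith)
    (fun a b ha hb => by
      have h1 := ((Real.continuous_exp.tendsto _).comp
        (tendsto_div_sq (-(1 / (1 + ρ)) * (a + b))
          ((a ^ 2 - 2 * ρ * a * b + b ^ 2) / (1 - ρ ^ 2)))).mul
        (h.tendsto ((a + b) / 2) (by positivity))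
      rw [← Real.exp_add, show -(1 / (1 + ρ)) * (a + b) + -η * ((a + b) / 2)
        = -(1 / (1 + ρ) + η / 2) * (a + b) by ring] at h1
      refine h1.congr' ?_
      filter_upwards [eventually_gt_atTop 0] with t ht
      rw [ratio t ht]; rfl)
  rwa [integral_exp_orthant (by positivity)] at key

/-! ### Elimination of the threshold -/

/-- If `M t ~ c t^(-k) exp (-K t² / 2)` then `-log (M t) ~ K t² / 2`. -/
theorem neg_log_isEquivalent {M : ℝ → ℝ} {c k K : ℝ} (hc : 0 < c) (hK : 0 < K)
    (hM : M ~[atTop] fun t => c * t ^ (-k) * Real.exp (-K * t ^ 2 / 2)) :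
    (fun t => -Real.log (M t)) ~[atTop] fun t => K / 2 * t ^ 2 := by
  have hne : ∀ᶠ t : ℝ in atTop, c * t ^ (-k) * Real.exp (-K * t ^ 2 / 2) ≠ 0 := by
    filter_upwards [eventually_gt_atTop 0] with t ht
    positivity
  have h1 := (isEquivalent_iff_tendsto_one hne).1 hM
  -- The ratio of `M` to its model tends to `1`, so their logarithms differ by `o(1)`; against `t²`
  -- that difference, `log t` and `log c` are all negligible.
  have h2 : Tendsto (fun t => Real.log ((M / fun t : ℝ =>
      c * t ^ (-k) * Real.exp (-K * t ^ 2 / 2)) t)) atTop (𝓝 0) := by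
    rw [← Real.log_one]
    exact (Real.continuousAt_log one_ne_zero).tendsto.comp h1
  have hsq : Tendsto (fun t : ℝ => t ^ 2) atTop atTop := tendsto_pow_atTop two_ne_zero
  have h3 : Tendsto (fun t : ℝ => Real.log t / t ^ 2) atTop (𝓝 0) := by
    simpa using (isLittleO_log_rpow_atTop (show (0 : ℝ) < 2 by norm_num)).tendsto_div_nhds_zero
  have hne2 : ∀ᶠ t : ℝ in atTop, K / 2 * t ^ 2 ≠ 0 := by
    filter_upwards [eventually_gt_atTop 0] with t ht
    positivity
  rw [isEquivalent_iff_tendsto_one hne2]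
  have h4 : Tendsto (fun t : ℝ => 1 + (2 / K) * (k * (Real.log t / t ^ 2)
      - Real.log c / t ^ 2 - Real.log ((M / fun t : ℝ =>
      c * t ^ (-k) * Real.exp (-K * t ^ 2 / 2)) t) / t ^ 2)) atTop
      (𝓝 (1 + 2 / K * (k * 0 - 0 - 0))) :=
    tendsto_const_nhds.add (tendsto_const_nhds.mul (((tendsto_const_nhds.mul h3).sub
      (tendsto_const_nhds.div_atTop hsq)).sub (h2.div_atTop hsq)))
  rw [show (1 + 2 / K * (k * 0 - 0 - 0) : ℝ) = 1 by ring] at h4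
  refine h4.congr' ?_
  filter_upwards [eventually_gt_atTop 0, h1.eventually (lt_mem_nhds one_pos)] with t ht hpos
  have hN : 0 < c * t ^ (-k) * Real.exp (-K * t ^ 2 / 2) := by positivity
  have hMt : 0 < M t := by
    simp only [Pi.div_apply] at hpos
    exact (div_pos_iff_of_pos_right hN).1 hpos
  simp only [Pi.div_apply]
  rw [Real.log_div hMt.ne' hN.ne', Real.log_mul (by positivity) (by positivity),
    Real.log_mul hc.ne' (by positivity), Real.log_rpow ht, Real.log_exp]
  field_simp
  ring

/-- Eliminating the threshold `t` between a marginal and a joint tail. -/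
theorem div_isEquivalent_of_tails {M J : ℝ → ℝ} {c k K d m b : ℝ} (hc : 0 < c) (hK : 0 < K)
    (hM : M ~[atTop] fun t => c * t ^ (-k) * Real.exp (-K * t ^ 2 / 2))
    (hJ : J ~[atTop] fun t => d * t ^ (-m) * Real.exp (-K * (1 + b) * t ^ 2 / 2)) :
    (fun t => J t / M t) ~[atTop] fun t => d * (c ^ (1 + b))⁻¹
      * (K / 2) ^ (-((k * (1 + b) - m) / 2)) * M t ^ b
      * (-Real.log (M t)) ^ ((k * (1 + b) - m) / 2) := by
  -- `J / M` carries `t^(k-m)` and `M^b` carries `t^(-kb)`; the missing `t^(k(1+b)-m) = t^(2p)`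
  -- comes from `(-log M)^p`.
  set p := (k * (1 + b) - m) / 2 with hp
  have hlog := neg_log_isEquivalent hc hK hM
  have hN0 : ∀ t : ℝ, 0 ≤ |c * t ^ (-k) * Real.exp (-K * t ^ 2 / 2)| := fun t => abs_nonneg _
  -- `IsEquivalent.rpow` needs a comparison function that is nonnegative everywhere, including at
  -- negative `t`.
  have hM' : M ~[atTop] fun t => |c * t ^ (-k) * Real.exp (-K * t ^ 2 / 2)| := by
    refine hM.congr_right ?_
    filter_upwards [eventually_gt_atTop 0] with t ht
    rw [abs_of_nonneg (by positivity)]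
  have hMb := hM'.rpow (r := b) hN0
  have hlp := hlog.rpow (r := p) fun t => (by positivity : (0 : ℝ) ≤ K / 2 * t ^ 2)
  have lhs := hJ.div hM
  have rhs := ((IsEquivalent.refl (u := fun _ : ℝ => d * (c ^ (1 + b))⁻¹ * (K / 2) ^ (-p))
    (l := atTop)).mul hMb).mul hlp
  refine (lhs.congr_right ?_).trans rhs.symm
  filter_upwards [eventually_gt_atTop 0] with t ht
  simp only [Pi.div_apply, Pi.mul_apply, Pi.pow_apply]
  rw [abs_of_nonneg (by positivity), Real.mul_rpow (by positivity) (by positivity),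
    Real.mul_rpow (by positivity) (by positivity), Real.mul_rpow (by positivity) (by positivity),
    ← Real.rpow_natCast t 2, ← Real.rpow_mul ht.le, ← Real.rpow_mul ht.le, ← Real.exp_mul,
    Real.rpow_natCast t 2, Real.rpow_neg (by positivity) p, Real.rpow_add hc, Real.rpow_one]
  have e1 : t ^ (-m) / t ^ (-k) = t ^ (-k * b) * t ^ (((2 : ℕ) : ℝ) * p) := by
    rw [← Real.rpow_sub ht, ← Real.rpow_add ht]
    congr 1
    rw [hp]; push_cast; ring
  have e2 : Real.exp (-K * (1 + b) * t ^ 2 / 2) / Real.exp (-K * t ^ 2 / 2)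
      = Real.exp (-K * t ^ 2 / 2 * b) := by
    rw [← Real.exp_sub]; congr 1; ring
  calc d * t ^ (-m) * Real.exp (-K * (1 + b) * t ^ 2 / 2)
        / (c * t ^ (-k) * Real.exp (-K * t ^ 2 / 2))
      = d / c * (t ^ (-m) / t ^ (-k))
        * (Real.exp (-K * (1 + b) * t ^ 2 / 2) / Real.exp (-K * t ^ 2 / 2)) := by
        field_simp
    _ = _ := by
        rw [e1, e2]
        have : c ^ b ≠ 0 := by positivity
        have : (K / 2) ^ p ≠ 0 := by positivity
        field_simp

/-! ### Quantiles and reduction to a ratio of tails -/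

/-- The quantile of a continuous distribution function is an exact right inverse. -/
theorem cdf_quantile {μ : Measure ℝ} [IsProbabilityMeasure μ] (hcont : Continuous (cdf μ))
    {u : ℝ} (hu0 : 0 < u) (hu1 : u < 1) : cdf μ (quantile μ u) = u := by
  set S : Set ℝ := {x : ℝ | u ≤ cdf μ x} with hS
  have hne : S.Nonempty := by
    obtain ⟨x, hx⟩ := ((tendsto_cdf_atTop μ).eventually (lt_mem_nhds hu1)).exists
    exact ⟨x, hx.le⟩
  have hbdd : BddBelow S := by
    obtain ⟨x, hx⟩ := ((tendsto_cdf_atBot μ).eventually (gt_mem_nhds hu0)).exists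
    refine ⟨x, fun y hy => ?_⟩
    by_contra! h
    exact absurd (hy.trans (monotone_cdf μ h.le)) (not_le.2 hx)
  have hcl : IsClosed S := isClosed_le continuous_const hcont
  refine le_antisymm ?_ (hcl.csInf_mem hne hbdd)
  -- Closedness of `S` gave `u ≤ F(sInf S)`; to the left of `sInf S` the cdf is below `u`, and
  -- continuity gives the reverse bound.
  have : Tendsto (cdf μ) (𝓝[<] sInf S) (𝓝 (cdf μ (sInf S))) :=
    hcont.continuousAt.mono_left nhdsWithin_le_nhds
  refine le_of_tendsto this ?_
  filter_upwards [self_mem_nhdsWithin] with x hx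
  by_contra! h
  exact absurd (csInf_le hbdd h.le) (not_le.2 hx)

/-- As `F(B) < 1`, every `u` strictly between `F(B)` and `1` has its quantile at or beyond `B`. -/
theorem tendsto_quantile {μ : Measure ℝ} [IsProbabilityMeasure μ] (hlt : ∀ x, cdf μ x < 1) :
    Tendsto (quantile μ) (𝓝[<] 1) atTop := by
  refine tendsto_atTop.2 fun B => ?_
  filter_upwards [Ioo_mem_nhdsLT (hlt B)] with u hu
  refine le_csInf ?_ fun x hx => ?_
  · obtain ⟨x, hx⟩ := ((tendsto_cdf_atTop μ).eventually (lt_mem_nhds hu.2)).exists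
    exact ⟨x, hx.le⟩
  · by_contra! h
    exact absurd (hx.trans (monotone_cdf μ h.le)) (not_le.2 hu.1)

/-- The jump of the cdf at a point is the mass of that point. -/
theorem continuous_cdf_of_nullSingletonClass (μ : Measure ℝ) [IsProbabilityMeasure μ]
    [NullSingletonClass μ] :
    Continuous (cdf μ) := by
  refine continuous_iff_continuousAt.2 fun x => ?_
  rw [(monotone_cdf μ).continuousAt_iff_leftLim_eq_rightLim, (cdf μ).rightLim_eq]
  have h := (cdf μ).measure_singleton x
  rw [measure_cdf, measure_singleton] at h
  exact le_antisymm ((monotone_cdf μ).leftLim_le le_rfl)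
    (sub_nonpos.1 (ENNReal.ofReal_eq_zero.1 h.symm))

theorem isEquivalent_of_tendsto_div {f N : ℝ → ℝ} {n : ℕ} {L : ℝ} (hL : L ≠ 0)
    (hN : ∀ t > 0, N t ≠ 0)
    (h : Tendsto (fun t => t ^ n * f t / N t) atTop (𝓝 L)) :
    f ~[atTop] fun t => L * N t / t ^ n := by
  have hne : ∀ᶠ t : ℝ in atTop, L * N t / t ^ n ≠ 0 := by
    filter_upwards [eventually_gt_atTop 0] with t ht
    have := hN t ht
    positivity
  rw [isEquivalent_iff_tendsto_one hne, ← div_self hL]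
  refine (h.div_const L).congr' ?_
  filter_upwards [eventually_gt_atTop 0] with t ht
  have := hN t ht
  simp only [Pi.div_apply]
  field_simp

/-- The upper tail dependence function at level `u` in terms of the joint and marginal tails at
the common quantile. -/
theorem upperTailDep_eq {Ω : Type*} [MeasurableSpace Ω] (P : Measure Ω) [IsProbabilityMeasure P]
    {ρ θ l : ℝ} (hρ : -1 < ρ) (hρ' : ρ < 1) (X : Ω → Fin 2 → ℝ)
    (hX : HasLaw X (skewNormal ![θ, θ] (corrMatrix ρ)) P)
    (hl : l = θ * (1 + ρ) / √(1 + θ ^ 2 * (1 - ρ ^ 2))) :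
    ∃ q : ℝ → ℝ, Tendsto q (𝓝[<] 1) atTop ∧ ∀ u, 0 < u → u < 1 →
      (∫ x in Set.Ioi (q u), marginalPDF l x) = 1 - u ∧
      upperTailDep P X u = (∫ x in Set.univ.pi fun _ => Set.Ioi (q u),
          skewNormalPDF ![θ, θ] (corrMatrix ρ) x) / (∫ x in Set.Ioi (q u), marginalPDF l x) := by
  set ν : Measure ℝ := volume.withDensity fun x => ENNReal.ofReal (marginalPDF l x) with hν
  have hXm := hX.aemeasurable
  have hXi : ∀ i, AEMeasurable (fun ω => X ω i) P := fun i =>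
    (measurable_pi_apply i).comp_aemeasurable hXm
  have hmap : ∀ i, P.map (fun ω => X ω i) = ν := by
    intro i
    have := AEMeasurable.map_map_of_aemeasurable (g := fun x : Fin 2 → ℝ => x i)
      (measurable_pi_apply i).aemeasurable hXm
    rw [hX.map_eq, skewNormal_map_eval hρ hρ', ← hl] at this
    exact this.symm
  have : IsProbabilityMeasure ν := hmap 0 ▸ Measure.isProbabilityMeasure_map (hXi 0)
  have hac : ν ≪ volume := withDensity_absolutelyContinuous _ _
  have : NullSingletonClass ν := ⟨fun x => hac (measure_singleton x)⟩
  have htail : ∀ t, ν.real (Set.Ioi t) = ∫ x in Set.Ioi t, marginalPDF l x := fun t =>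
    real_withDensity_ofReal _ (measurable_marginalPDF l) (fun x => (marginalPDF_pos l x).le)
      measurableSet_Ioi
  have hcompl : ∀ t, ν.real (Set.Ioi t) = 1 - cdf ν t := by
    intro t
    rw [cdf_eq_real, ← Set.compl_Iic, probReal_compl_eq_one_sub measurableSet_Iic]
  have hlt : ∀ t, cdf ν t < 1 := by
    intro t
    have h0 : 0 < ν.real (Set.Ioi t) := by
      refine ENNReal.toReal_pos (fun h => ?_) (measure_ne_top _ _)
      rw [hν, withDensity_apply_eq_zero (by
        have := measurable_marginalPDF l
        fun_prop)] at h
      have e : {x | ENNReal.ofReal (marginalPDF l x) ≠ 0} = Set.univ := by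
        ext x; simp [marginalPDF_pos l x]
      rw [e, Set.univ_inter] at h
      simp at h
    rw [hcompl] at h0
    linarith
  refine ⟨quantile ν, tendsto_quantile hlt, fun u hu0 hu1 => ?_⟩
  have hq : (∫ x in Set.Ioi (quantile ν u), marginalPDF l x) = 1 - u := by
    rw [← htail, hcompl, cdf_quantile (continuous_cdf_of_nullSingletonClass ν) hu0 hu1]
  refine ⟨hq, ?_⟩
  rw [upperTailDep, hmap, hmap]
  set t := quantile ν u
  have hs : ∀ i, {ω | t ≤ X ω i} = (fun ω => X ω i) ⁻¹' Set.Ici t := fun i => rfl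
  have hnull : NullMeasurableSet {ω | t ≤ X ω 1} P :=
    (hXi 1).nullMeasurableSet_preimage measurableSet_Ici
  -- The events use `≥` and the tail integrals `>`; absolute continuity makes the boundary null,
  -- here and for the orthant.
  have h1 : P {ω | t ≤ X ω 1} = ν (Set.Ioi t) := by
    rw [hs, ← Measure.map_apply_of_aemeasurable (hXi 1) measurableSet_Ici, hmap,
      measure_congr Ioi_ae_eq_Ici]
  have h2 : P ({ω | t ≤ X ω 0} ∩ {ω | t ≤ X ω 1})
      = skewNormal ![θ, θ] (corrMatrix ρ) (Set.univ.pi fun _ => Set.Ioi t) := by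
    have e : {ω | t ≤ X ω 0} ∩ {ω | t ≤ X ω 1} = X ⁻¹' (Set.univ.pi fun _ => Set.Ici t) := by
      ext ω; simp only [Set.mem_inter_iff, Set.mem_ofPred_eq, Set.mem_preimage, Set.mem_univ_pi,
        Set.mem_Ici, Fin.forall_fin_two]
    rw [e, ← Measure.map_apply_of_aemeasurable hXm
      (MeasurableSet.univ_pi fun _ => measurableSet_Ici), hX.map_eq]
    have hac2 : skewNormal ![θ, θ] (corrMatrix ρ) ≪ volume := withDensity_absolutelyContinuous _ _
    have hae : (Set.univ.pi fun _ : Fin 2 => Set.Ioi t)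
        =ᵐ[volume] Set.univ.pi fun _ : Fin 2 => Set.Ici t := by
      rw [Set.pi_univ_Ici]
      exact Measure.univ_pi_Ioi_ae_eq_Ici (f := fun _ => t)
    exact (measure_congr (hac2.ae_eq hae)).symm
  rw [measureReal_def, ProbabilityTheory.cond, Measure.smul_apply,
    Measure.restrict_apply₀' hnull, h1, h2, smul_eq_mul, ENNReal.toReal_mul, ENNReal.toReal_inv,
    ← measureReal_def, ← measureReal_def, htail, skewNormal,
    real_withDensity_ofReal _ (measurable_skewNormalPDF hρ hρ' θ)
      (fun x => (skewNormalPDF_pos hρ hρ' θ x).le)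
      (MeasurableSet.univ_pi fun _ => measurableSet_Ioi), div_eq_inv_mul]

/-- Asymptotics of the upper tail dependence function from those of the two tails. -/
theorem upperTailDep_isEquivalent {Ω : Type*} [MeasurableSpace Ω] (P : Measure Ω)
    [IsProbabilityMeasure P] {ρ θ l c k K d m b : ℝ} (hρ : -1 < ρ) (hρ' : ρ < 1)
    (X : Ω → Fin 2 → ℝ) (hX : HasLaw X (skewNormal ![θ, θ] (corrMatrix ρ)) P)
    (hl : l = θ * (1 + ρ) / √(1 + θ ^ 2 * (1 - ρ ^ 2))) (hc : 0 < c) (hK : 0 < K)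
    (hM : (fun t => ∫ x in Set.Ioi t, marginalPDF l x) ~[atTop]
      fun t => c * t ^ (-k) * Real.exp (-K * t ^ 2 / 2))
    (hJ : (fun t => ∫ x in Set.univ.pi fun _ => Set.Ioi t,
        skewNormalPDF ![θ, θ] (corrMatrix ρ) x) ~[atTop]
      fun t => d * t ^ (-m) * Real.exp (-K * (1 + b) * t ^ 2 / 2)) :
    (fun u => upperTailDep P X u) ~[𝓝[<] 1] fun u => d * (c ^ (1 + b))⁻¹
      * (K / 2) ^ (-((k * (1 + b) - m) / 2)) * (1 - u) ^ b
      * (-Real.log (1 - u)) ^ ((k * (1 + b) - m) / 2) := by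
  obtain ⟨q, hq, hqu⟩ := upperTailDep_eq P hρ hρ' X hX hl
  have h := (div_isEquivalent_of_tails hc hK hM hJ).comp_tendsto hq
  have hmem : Set.Ioo (0 : ℝ) 1 ∈ 𝓝[<] (1 : ℝ) := Ioo_mem_nhdsLT one_pos
  refine (h.congr_left ?_).congr_right ?_
  · filter_upwards [hmem] with u hu
    exact (hqu u hu.1 hu.2).2.symm
  · filter_upwards [hmem] with u hu
    simp only [Function.comp, (hqu u hu.1 hu.2).1]

/-! ### Explicit tails and constants for each sign of `θ` -/

theorem marginal_tail_isEquivalent_pos {l : ℝ} (hl : 0 < l) :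
    (fun t => ∫ x in Set.Ioi t, marginalPDF l x) ~[atTop]
      fun t => 2 / √(2 * Real.pi) * t ^ (-1 : ℝ) * Real.exp (-1 * t ^ 2 / 2) := by
  have h := isEquivalent_of_tendsto_div (n := 1) (L := 1) one_ne_zero
    (N := fun t => 2 * gaussianPDFReal 0 1 t) (fun t _ => by have := stdNormalPDF_pos t; positivity)
    (by simpa using marginal_tail_tendsto (isTailFactor_pos hl))
  refine h.congr_right ?_
  filter_upwards [eventually_gt_atTop 0] with t ht
  rw [stdNormalPDF_eq, Real.rpow_neg_one, neg_one_mul]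
  field_simp

theorem joint_tail_isEquivalent_pos {ρ θ : ℝ} (hρ : -1 < ρ) (hρ' : ρ < 1) (hθ : 0 < θ) :
    (fun t => ∫ x in Set.univ.pi fun _ => Set.Ioi t,
        skewNormalPDF ![θ, θ] (corrMatrix ρ) x) ~[atTop]
      fun t => (1 + ρ) ^ 2 / (Real.pi * √(1 - ρ ^ 2)) * t ^ (-2 : ℝ)
        * Real.exp (-1 * (1 + (1 - ρ) / (1 + ρ)) * t ^ 2 / 2) := by
  have hs : 0 < √(1 - ρ ^ 2) := Real.sqrt_pos.2 (by nlinarith)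
  have hρ1 : 0 < 1 + ρ := by linarith
  have h := isEquivalent_of_tendsto_div (n := 2) (by positivity)
    (fun t _ => by positivity)
    (joint_tail_tendsto hρ hρ' (isTailFactor_pos (mul_pos two_pos hθ)))
  refine h.congr_right ?_
  filter_upwards [eventually_gt_atTop 0] with t ht
  rw [Real.rpow_neg ht.le, Real.rpow_two]
  have e : -1 * (1 + (1 - ρ) / (1 + ρ)) * t ^ 2 / 2 = -t ^ 2 / (1 + ρ) := by
    field_simp; ring
  rw [e]
  field_simp
  ring

theorem stdNormalPDF_mul (s t : ℝ) :
    gaussianPDFReal 0 1 s * gaussianPDFReal 0 1 t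
      = 1 / (2 * Real.pi) * Real.exp (-(s ^ 2 + t ^ 2) / 2) := by
  have e2 : √(2 * Real.pi) * √(2 * Real.pi) = 2 * Real.pi := Real.mul_self_sqrt (by positivity)
  rw [stdNormalPDF_eq, stdNormalPDF_eq, mul_mul_mul_comm, ← mul_inv, e2, ← Real.exp_add, one_div]
  congr 2
  ring

/-- The rate `1 + lam²` comes from `φ(t) φ(lam t)`; one power of `1/t` comes from the tail integral,
the other from Mills' ratio. -/
theorem marginal_tail_isEquivalent_neg {lam : ℝ} (hl : 0 < lam) :
    (fun t => ∫ x in Set.Ioi t, marginalPDF (-lam) x) ~[atTop]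
      fun t => 1 / (Real.pi * lam * (1 + lam ^ 2)) * t ^ (-2 : ℝ)
        * Real.exp (-(1 + lam ^ 2) * t ^ 2 / 2) := by
  have h := isEquivalent_of_tendsto_div (n := 1) (L := (1 + lam ^ 2)⁻¹) (by positivity)
    (N := fun t => 2 * gaussianPDFReal 0 1 t * (gaussianPDFReal 0 1 (lam * t) / (lam * t)))
    (fun t ht => by
      have := stdNormalPDF_pos t
      have := (isTailFactor_neg hl).pos t ht
      positivity)
    (by simpa using marginal_tail_tendsto (isTailFactor_neg hl))
  refine h.congr_right ?_
  filter_upwards [eventually_gt_atTop 0] with t ht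
  have e := stdNormalPDF_mul t (lam * t)
  rw [show -(t ^ 2 + (lam * t) ^ 2) / 2 = -(1 + lam ^ 2) * t ^ 2 / 2 by ring] at e
  rw [mul_assoc 2, ← mul_div_assoc, e, Real.rpow_neg ht.le, Real.rpow_two]
  field_simp

/-- Here `κ = 2|θ|` and `η = 4θ²`, so `Φ` adds `2θ²` to the Gaussian rate; `t^(-3)` is two powers
from the corner and one from Mills' ratio. -/
theorem joint_tail_isEquivalent_neg {ρ θ : ℝ} (hρ : -1 < ρ) (hρ' : ρ < 1) (hθ : θ < 0) :
    (fun t => ∫ x in Set.univ.pi fun _ => Set.Ioi t,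
        skewNormalPDF ![θ, θ] (corrMatrix ρ) x) ~[atTop]
      fun t => 1 / (Real.pi * √(1 - ρ ^ 2) * √(2 * Real.pi) * (2 * |θ|)
          * (1 / (1 + ρ) + 2 * θ ^ 2) ^ 2) * t ^ (-3 : ℝ)
        * Real.exp (-(1 / (1 + ρ) + 2 * θ ^ 2) * t ^ 2) := by
  have hs : 0 < √(1 - ρ ^ 2) := Real.sqrt_pos.2 (by nlinarith)
  have hρ1 : 0 < 1 + ρ := by linarith
  have habs : |θ| = -θ := abs_of_neg hθ
  have hκ : 0 < 2 * |θ| := by rw [habs]; linarith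
  have hf := isTailFactor_neg hκ
  have hη : (2 * |θ|) ^ 2 = 4 * θ ^ 2 := by rw [mul_pow, sq_abs]; norm_num
  rw [show -(2 * |θ|) = 2 * θ by rw [habs]; ring, hη] at hf
  have hg : 1 / (1 + ρ) + 4 * θ ^ 2 / 2 = 1 / (1 + ρ) + 2 * θ ^ 2 := by ring
  have hlim := joint_tail_tendsto hρ hρ' hf
  rw [hg] at hlim
  have hgpos : 0 < 1 / (1 + ρ) + 2 * θ ^ 2 := by positivity
  have h := isEquivalent_of_tendsto_div (n := 2) (by positivity)
    (fun t ht => by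
      have := hf.pos t ht
      positivity) hlim
  refine h.congr_right ?_
  filter_upwards [eventually_gt_atTop 0] with t ht
  have e : Real.exp (-(1 / (1 + ρ) + 2 * θ ^ 2) * t ^ 2)
      = Real.exp (-t ^ 2 / (1 + ρ)) * Real.exp (-(2 * |θ| * t) ^ 2 / 2) := by
    rw [← Real.exp_add, mul_pow _ t, hη]
    congr 1
    ring
  rw [e, stdNormalPDF_eq, Real.rpow_neg ht.le, show (3 : ℝ) = ((3 : ℕ) : ℝ) by norm_num,
    Real.rpow_natCast]
  generalize 1 / (1 + ρ) + 2 * θ ^ 2 = g at hgpos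
  field_simp

/-- With `A` and `B` the radicands in `α` and `lam`, `1 + β² = 2B/(1+ρ)` and `1/(1+ρ) + 2θ² =
A/(1+ρ)`; then `B` cancels between `lam^4` and `(1+β²)²`. -/
theorem tailDep_const_neg {ρ θ lam α β : ℝ} (hρ : -1 < ρ) (hρ' : ρ < 1) (hθ : θ < 0)
    (hlam : lam = |θ| * (1 + ρ) / √(1 + θ ^ 2 * (1 - ρ ^ 2)))
    (hα : α = |θ| * (1 + ρ) / √(1 + 2 * θ ^ 2 * (1 + ρ)))
    (hβ : β = √((1 - ρ) * (1 + 2 * θ ^ 2 * (1 + ρ)) / (1 + ρ))) :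
    1 / (Real.pi * √(1 - ρ ^ 2) * √(2 * Real.pi) * (2 * |θ|) * (1 / (1 + ρ) + 2 * θ ^ 2) ^ 2)
      = α ^ 3 / (Real.pi * lam ^ 4 * β * (1 + β ^ 2) ^ 2) * √(2 / Real.pi) := by
  have hρ1 : 0 < 1 + ρ := by linarith
  have hρ2 : 0 < 1 - ρ := by linarith
  have hT : 0 < |θ| := abs_pos.2 hθ.ne
  set A := 1 + 2 * θ ^ 2 * (1 + ρ) with hA
  have hApos : 0 < A := by positivity
  set B := 1 + θ ^ 2 * (1 - ρ ^ 2) with hB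
  have hBpos : 0 < B := by
    rw [hB, show 1 - ρ ^ 2 = (1 - ρ) * (1 + ρ) by ring]; positivity
  have hβ2 : 1 + β ^ 2 = 2 * B / (1 + ρ) := by
    rw [hβ, Real.sq_sqrt (by positivity), hA, hB]
    field_simp
    ring
  have hg : 1 / (1 + ρ) + 2 * θ ^ 2 = A / (1 + ρ) := by
    rw [hA]; field_simp
  have hβ' : β = √(1 - ρ) * √A / √(1 + ρ) := by
    rw [hβ, Real.sqrt_div (by positivity), Real.sqrt_mul hρ2.le]
  have hr : √(1 - ρ ^ 2) = √(1 - ρ) * √(1 + ρ) := by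
    rw [← Real.sqrt_mul hρ2.le]; congr 1; ring
  rw [hβ2, hg, hβ', hr, hα, hlam, Real.sqrt_mul two_pos.le, Real.sqrt_div two_pos.le]
  -- Writing each quantity as the square of its root turns the claim into a rational identity in
  -- those roots.
  have eA : A = √A ^ 2 := (Real.sq_sqrt hApos.le).symm
  have eB : B = √B ^ 2 := (Real.sq_sqrt hBpos.le).symm
  have e1 : 1 + ρ = √(1 + ρ) ^ 2 := (Real.sq_sqrt hρ1.le).symm
  have e2 : (2 : ℝ) = √2 ^ 2 := (Real.sq_sqrt two_pos.le).symm
  have pA := Real.sqrt_pos.2 hApos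
  have pB := Real.sqrt_pos.2 hBpos
  have p1 := Real.sqrt_pos.2 hρ1
  have p2 := Real.sqrt_pos.2 hρ2
  have p3 := Real.sqrt_pos.2 (two_pos (α := ℝ))
  have p4 := Real.sqrt_pos.2 Real.pi_pos
  generalize √A = a at *
  generalize √B = b at *
  generalize √(1 + ρ) = r at *
  generalize √(1 - ρ) = s at *
  generalize √Real.pi = w at *
  rw [eA, eB, e1]
  field_simp
  rw [← e2]

end SkewNormal

theorem mainTheorem3 {Ω : Type*} [MeasurableSpace Ω] (P : Measure Ω) [IsProbabilityMeasure P]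
    (ρ θ : ℝ) (hρ : -1 < ρ) (hρ' : ρ < 1)
    (X : Ω → Fin 2 → ℝ)
    (hX : HasLaw X (SkewNormal.skewNormal ![θ, θ] (SkewNormal.corrMatrix ρ)) P) :
    (θ < 0 → ∀ lam α β : ℝ,
      lam = |θ| * (1 + ρ) / √(1 + θ ^ 2 * (1 - ρ ^ 2)) →
      α = |θ| * (1 + ρ) / √(1 + 2 * θ ^ 2 * (1 + ρ)) →
      β = √((1 - ρ) * (1 + 2 * θ ^ 2 * (1 + ρ)) / (1 + ρ)) →
      (fun u : ℝ => SkewNormal.upperTailDep P X u) ~[𝓝[<] (1 : ℝ)]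
        fun u : ℝ =>
          (1 - u) ^ (β ^ 2) * (α ^ 3 / (Real.pi * lam ^ 4 * β * (1 + β ^ 2) ^ 2))
            * √(2 / Real.pi) * (2 * Real.pi * lam) ^ (1 + β ^ 2)
            * ((1 + lam ^ 2) / 2) ^ (3 / 2 : ℝ)
            * (-Real.log (1 - u)) ^ (β ^ 2 - 1 / 2)) ∧
    (0 < θ →
      (fun u : ℝ => SkewNormal.upperTailDep P X u) ~[𝓝[<] (1 : ℝ)]
        fun u : ℝ =>
          (1 - u) ^ ((1 - ρ) / (1 + ρ)) * ((1 + ρ) / 2) * √((1 + ρ) / (1 - ρ))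
            * (-Real.pi * Real.log (1 - u)) ^ (-(ρ / (1 + ρ)))) := by
  have hρ1 : 0 < 1 + ρ := by linarith
  have hρ2 : 0 < 1 - ρ := by linarith
  have hpi := Real.pi_pos
  have hBpos : 0 < 1 + θ ^ 2 * (1 - ρ ^ 2) := by
    rw [show 1 - ρ ^ 2 = (1 - ρ) * (1 + ρ) by ring]; positivity
  have hsB := Real.sqrt_pos.2 hBpos
  constructor
  · intro hθ lam α β hlam hα hβ
    have hT : 0 < |θ| := abs_pos.2 hθ.ne
    have hlpos : 0 < lam := by rw [hlam]; positivity
    have hl : -lam = θ * (1 + ρ) / √(1 + θ ^ 2 * (1 - ρ ^ 2)) := by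
      rw [hlam, abs_of_neg hθ]; ring
    -- The defining role of `β`: the joint exponential rate is `1 + β²` times the marginal one, so
    -- `b = β²`.
    have hrel : (1 + lam ^ 2) * (1 + β ^ 2) = 2 * (1 / (1 + ρ) + 2 * θ ^ 2) := by
      have h1 : lam ^ 2 = θ ^ 2 * (1 + ρ) ^ 2 / (1 + θ ^ 2 * (1 - ρ ^ 2)) := by
        rw [hlam, div_pow, mul_pow, sq_abs, Real.sq_sqrt hBpos.le]
      have h2 : β ^ 2 = (1 - ρ) * (1 + 2 * θ ^ 2 * (1 + ρ)) / (1 + ρ) := by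
        rw [hβ, Real.sq_sqrt (by positivity)]
      rw [h1, h2]
      field_simp
      ring
    have hJ := SkewNormal.joint_tail_isEquivalent_neg hρ hρ' hθ
    rw [SkewNormal.tailDep_const_neg hρ hρ' hθ hlam hα hβ] at hJ
    have hexp : ∀ t : ℝ, -(1 / (1 + ρ) + 2 * θ ^ 2) * t ^ 2
        = -(1 + lam ^ 2) * (1 + β ^ 2) * t ^ 2 / 2 := by
      intro t
      rw [neg_mul (1 + lam ^ 2), hrel]; ring
    simp only [hexp] at hJ
    have h := SkewNormal.upperTailDep_isEquivalent P hρ hρ' X hX hl (by positivity)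
      (by positivity) (SkewNormal.marginal_tail_isEquivalent_neg hlpos) hJ
    refine h.congr_right (Eventually.of_forall fun u => ?_)
    have hp : (2 * (1 + β ^ 2) - 3) / 2 = β ^ 2 - 1 / 2 := by ring
    have hK : 0 < (1 + lam ^ 2) / 2 := by positivity
    -- Here `1/c = 2π lam · (K/2)` with `K = 1 + lam²`, and the powers of `K/2` add up to `(1+β²) -
    -- (β²-1/2) = 3/2`.
    have hc : ((1 / (Real.pi * lam * (1 + lam ^ 2))) ^ (1 + β ^ 2))⁻¹
          * ((1 + lam ^ 2) / 2) ^ (-(β ^ 2 - 1 / 2))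
        = (2 * Real.pi * lam) ^ (1 + β ^ 2) * ((1 + lam ^ 2) / 2) ^ (3 / 2 : ℝ) := by
      rw [← Real.inv_rpow (by positivity), one_div, inv_inv,
        show Real.pi * lam * (1 + lam ^ 2) = 2 * Real.pi * lam * ((1 + lam ^ 2) / 2) by ring,
        Real.mul_rpow (by positivity) hK.le, mul_assoc, ← Real.rpow_add hK]
      congr 2
      ring
    simp only [hp]
    rw [mul_assoc (_ * √(2 / Real.pi)), hc]
    ring
  · intro hθ
    have h := SkewNormal.upperTailDep_isEquivalent P hρ hρ' X hX rfl (by positivity)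
      one_pos (SkewNormal.marginal_tail_isEquivalent_pos (by positivity))
      (SkewNormal.joint_tail_isEquivalent_pos hρ hρ' hθ)
    refine h.congr_right ?_
    filter_upwards [Ioo_mem_nhdsLT (zero_lt_one (α := ℝ))] with u hu
    have hlog : 0 ≤ -Real.log (1 - u) :=
      neg_nonneg.2 (Real.log_nonpos (by linarith [hu.2]) (by linarith [hu.1]))
    have hp : (1 * (1 + (1 - ρ) / (1 + ρ)) - 2) / 2 = -(ρ / (1 + ρ)) := by
      field_simp; ring
    -- With `p` the exponent of the logarithm, `1 + b = 2(1 + p)` removes the square root from `c`;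
    -- this leaves `π/2`, which joins the constant, and `π^p`, which joins the logarithm.
    have hb : 1 + (1 - ρ) / (1 + ρ) = 2 * (1 + -(ρ / (1 + ρ))) := by
      field_simp; ring
    simp only [hp]
    rw [hb]
    set p := -(ρ / (1 + ρ))
    have hc : ((2 / √(2 * Real.pi)) ^ (2 * (1 + p)))⁻¹ * (1 / 2 : ℝ) ^ (-p)
        = Real.pi / 2 * Real.pi ^ p := by
      have e : (2 / √(2 * Real.pi)) ^ (2 : ℝ) = (Real.pi / 2)⁻¹ := by
        rw [Real.rpow_two, div_pow, Real.sq_sqrt (by positivity)]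
        field_simp
      rw [Real.rpow_mul (by positivity), e, Real.inv_rpow (by positivity), inv_inv,
        Real.rpow_neg (by positivity), ← Real.inv_rpow (by positivity), Real.rpow_add
        (by positivity), Real.rpow_one, mul_assoc, ← Real.mul_rpow (by positivity) (by positivity)]
      congr 2
      field_simp
    have hd : (1 + ρ) ^ 2 / (Real.pi * √(1 - ρ ^ 2)) * (Real.pi / 2)
        = (1 + ρ) / 2 * √((1 + ρ) / (1 - ρ)) := by
      have hr : √(1 - ρ ^ 2) = √(1 - ρ) * √(1 + ρ) := by
        rw [← Real.sqrt_mul hρ2.le]; congr 1; ring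
      have e1 : √(1 + ρ) ^ 2 = 1 + ρ := Real.sq_sqrt hρ1.le
      have p1 := Real.sqrt_pos.2 hρ1
      have p2 := Real.sqrt_pos.2 hρ2
      rw [hr, Real.sqrt_div hρ1.le]
      field_simp
      rw [e1]
    rw [show -Real.pi * Real.log (1 - u) = Real.pi * -Real.log (1 - u) by ring,
      Real.mul_rpow hpi.le hlog, mul_assoc ((1 + ρ) ^ 2 / _), hc, ← mul_assoc, hd]
    ring
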